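/- Let $n\ge 3$, $S=\mathrm{SO}(n)$, $H=\{h\in S: h e_n=e_n\}$, with Lie algebra $\mathfrak h=\{Y\in\mathfrak{so}(n):Ye_n=0\}$. Trivialize $TS=S\times\mathfrak{so}(n)$ by left multiplication and let $\langle u,v\rangle=-\tfrac12\operatorname{tr}(uv)$ on $\mathfrak{so}(n)$. Let $\mathbb I:\mathfrak{so}(n)\to\mathfrak{so}(n)$ be linear, symmetric and positive definite with respect to $\langle\cdot,\cdot\rangle$ (the inertia tensor of the Chaplygin ball), let $$\mathcal A_s(u)=-\sum_{a=1}^{n-1}\langle e_a,(sus^{-1})e_n\rangle_E\,e_a\in\mathbb R^{n-1}$$ be the form defining the rolling constraint $x'=-\mathcal A_s(u)$, and let $(\mu_0)_s(u,v)=\langle\mathbb I u,v\rangle+\langle\mathcal A_s(u),\mathcal A_s(v)\rangle_E$ be the induced metric on $S$. The group $H$ acts on $S$ by left multiplication, with infinitesimal generators $\zeta_Y(s)=\mathrm{Ad}(s^{-1})Y$, on $TS$ by $h(s,u)=(hs,u)$, and on $\mathfrak h^*$ by the coadjoint action. Under the identification $TS\cong T^*S$ given by $\mu_0$, the momentum map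 $J_H:TS\to\mathfrak h^*$ is $\langle J_H(s,u),Y\rangle=(\mu_0)_s(u,\zeta_Y(s))$. Let $\kappa:S\to S/H=S^{n-1}$, $\kappa(s)=s^{-1}e_n$, with tangent map $T\kappa:TS\to TS^{n-1}$. Let $\mathbb L(s):\mathfrak h\to\mathfrak h^*$, $\langle\mathbb L(s)Y,Y'\rangle=(\mu_0)_s(\zeta_Y(s),\zeta_{Y'}(s))$, be the locked inertia tensor, and let the mechanical connection on $S\to S/H$ associated to $\mu_0$ be the one with connection form $(s,u)\mapsto\mathbb L(s)^{-1}J_H(s,u)\in\mathfrak h$. Let $\mathcal O\subset\mathfrak h^*$ be a coadjoint orbit and let $S\times_H\mathcal O$ be the quotient of $S\times\mathcal O$ by the diagonal action $h(s,\nu)=(hs,h\nu)$, a bundle over $S^{n-1}$ via $[s,\nu]\mapsto\kappa(s)$. Then there is a diffeomorphism $$\Phi:J_H^{-1}(\mathcal O)/H\;\longrightarrow\;TS^{n-1}\times_{S^{n-1}}(S\times_H\mathcal O),\qquad \Phi[s,u]=\big(T\kappa(s,u),[s,J_H(s,u)]\big).$$ It is determined by the mechanical connection of $\mu_0$ as follows: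 for $(x,v)\in TS^{n-1}$, $s\in S$ with $\kappa(s)=x$, and $\nu\in\mathcal O$, there is a unique $u\in\mathfrak{so}(n)$ that is horizontal at $s$ for the mechanical connection and satisfies $T\kappa(s,u)=(x,v)$, and $$\Phi^{-1}\big((x,v),[s,\nu]\big)=\big[s,\;u+\zeta_{\mathbb L(s)^{-1}\nu}(s)\big].$$ In particular, through $\Phi$ and the projection to $TS^{n-1}$, the reduced space $J_H^{-1}(\mathcal O)/H$ is a smooth locally trivial fiber bundle over $TS^{n-1}$ with fiber $\mathcal O$. -/

import Mathlib

open Diffeology Topology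
open scoped ContDiff Matrix

/-! ### Smooth structures on subsets, products and quotients

All spaces below are obtained from Euclidean spaces by passing to subsets, products and quotients.
Their smooth structures are described by diffeologies, that is, by declaring which maps from `ℝᵏ`
are smooth. On an embedded submanifold (subset diffeology), on a product of manifolds and on the
quotient of a manifold by a free proper action these are exactly the maps that are smooth for the
usual manifold structure, so smooth maps and diffeomorphisms have their usual meaning. -/

namespace SmoothStructure

/-- The diffeology on `X` in which a map from `ℝᵏ` is smooth iff its composition with `f` is. -/
@[reducible] def induced {X Y : Type*} [DiffeologicalSpace Y] (f : X → Y) :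
    DiffeologicalSpace X where
  plots _ := {p | IsPlot (f ∘ p)}
  constant_plots x := isPlot_const (x := f x)
  plot_reparam hp hf := isPlot_reparam hp hf
  locality h := DiffeologicalSpace.locality fun x => by
    obtain ⟨u, hu, hx, H⟩ := h x
    exact ⟨u, hu, hx, fun hm hf => H hm hf⟩

/-- The diffeology on `X` in which a map from `ℝᵏ` is smooth iff all its coordinates `c i` are. -/
@[reducible] def ofCoordinates {X ι : Type*} (c : ι → X → ℝ) : DiffeologicalSpace X where
  plots _ := {p | ∀ i, IsPlot (c i ∘ p)}
  constant_plots x := fun i => isPlot_const (x := c i x)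
  plot_reparam hp hf := fun i => isPlot_reparam (hp i) hf
  locality h := fun i => DiffeologicalSpace.locality fun x => by
    obtain ⟨u, hu, hx, H⟩ := h x
    exact ⟨u, hu, hx, fun hm hf => H hm hf i⟩

instance {X : Type*} [DiffeologicalSpace X] (P : X → Prop) : DiffeologicalSpace {x // P x} :=
  induced Subtype.val

/-- The product diffeology. -/
instance {X Y : Type*} [DiffeologicalSpace X] [DiffeologicalSpace Y] :
    DiffeologicalSpace (X × Y) where
  plots _ := {p | IsPlot (Prod.fst ∘ p) ∧ IsPlot (Prod.snd ∘ p)}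
  constant_plots x := ⟨isPlot_const (x := x.1), isPlot_const (x := x.2)⟩
  plot_reparam hp hf := ⟨isPlot_reparam hp.1 hf, isPlot_reparam hp.2 hf⟩
  locality h := by
    constructor
    · refine DiffeologicalSpace.locality fun x => ?_
      obtain ⟨u, hu, hx, H⟩ := h x
      exact ⟨u, hu, hx, fun hm hf => (H hm hf).1⟩
    · refine DiffeologicalSpace.locality fun x => ?_
      obtain ⟨u, hu, hx, H⟩ := h x
      exact ⟨u, hu, hx, fun hm hf => (H hm hf).2⟩

/-- A smooth map of `ℝᵏ` into a given neighbourhood of `x` that is the identity near `x`. -/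
theorem exists_smooth_retraction {k : ℕ} {u : Set (EuclideanSpace ℝ (Fin k))} (hu : IsOpen u)
    {x : EuclideanSpace ℝ (Fin k)} (hx : x ∈ u) :
    ∃ φ : EuclideanSpace ℝ (Fin k) → EuclideanSpace ℝ (Fin k),
      (∀ y, φ y ∈ u) ∧ ContDiff ℝ ∞ φ ∧ ∀ᶠ y in 𝓝 x, φ y = y := by
  obtain ⟨ε, hε, hb⟩ := Metric.isOpen_iff.1 hu x hx
  let f : ContDiffBump x := ⟨ε / 2, ε, by positivity, by linarith⟩
  refine ⟨fun y => x + f y • (y - x), fun y => hb ?_, ?_, ?_⟩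
  · by_cases hy : dist y x < ε
    · rw [Metric.mem_ball, dist_eq_norm, add_sub_cancel_left, norm_smul, Real.norm_eq_abs,
        abs_of_nonneg f.nonneg]
      rw [dist_eq_norm] at hy
      calc f y * ‖y - x‖ ≤ 1 * ‖y - x‖ := by gcongr; exact f.le_one
        _ < ε := by simpa using hy
    · have : f y = 0 := f.zero_of_le_dist (not_lt.1 hy)
      simpa [this] using hε
  · exact contDiff_const.add (f.contDiff.smul (contDiff_id.sub contDiff_const))
  · filter_upwards [f.eventuallyEq_one] with y hy
    have : f y = 1 := hy
    simp [this]

/-- The quotient diffeology: a map from `ℝᵏ` into a quotient is smooth iff it lifts, near each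
point, to a smooth map. -/
instance {X : Type*} [DiffeologicalSpace X] (r : Setoid X) : DiffeologicalSpace (Quotient r) where
  plots k := {p | ∀ x, ∃ q : EuclideanSpace ℝ (Fin k) → X,
    IsPlot q ∧ ∀ᶠ y in 𝓝 x, p y = Quotient.mk r (q y)}
  constant_plots z := fun _ => by
    obtain ⟨a, rfl⟩ := Quotient.exists_rep z
    exact ⟨fun _ => a, isPlot_const, Filter.Eventually.of_forall fun _ => rfl⟩
  plot_reparam {n m p f} hp hf := fun x => by
    obtain ⟨q, hq, h⟩ := hp (f x)
    exact ⟨q ∘ f, isPlot_reparam hq hf, hf.continuous.continuousAt.eventually h⟩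
  locality {n p} h := fun x => by
    obtain ⟨u, hu, hx, H⟩ := h x
    obtain ⟨φ, hφu, hφ, hid⟩ := exists_smooth_retraction hu hx
    obtain ⟨q, hq, hpq⟩ := H hφu hφ x
    refine ⟨q, hq, ?_⟩
    filter_upwards [hpq, hid] with y h1 h2
    rw [← h1, Function.comp_apply, h2]

instance {m n : Type*} : DiffeologicalSpace (Matrix m n ℝ) :=
  ofCoordinates (fun (ij : m × n) A => A ij.1 ij.2)

/-- Smoothness in the dual `V*` of a finite-dimensional vector space, tested on all `Y ∈ V`. -/
instance {V : Type*} [AddCommGroup V] [Module ℝ V] : DiffeologicalSpace (Module.Dual ℝ V) :=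
  ofCoordinates (fun (Y : V) (ν : Module.Dual ℝ V) => ν Y)

/-- A diffeomorphism, as a property of a bijection. -/
def IsDiffeo {X Y : Type*} [DiffeologicalSpace X] [DiffeologicalSpace Y] (e : X ≃ Y) : Prop :=
  DSmooth e ∧ DSmooth e.symm

/-- `p : X → B` is a smooth, locally trivial fibre bundle with typical fibre `F`. -/
def IsFiberBundle {X B : Type*} [DiffeologicalSpace X] [TopologicalSpace B] [DiffeologicalSpace B]
    (F : Type*) [DiffeologicalSpace F] (p : X → B) : Prop :=
  DSmooth p ∧ ∀ b : B, ∃ U : Set B, IsOpen U ∧ b ∈ U ∧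
    ∃ e : {x : X // p x ∈ U} ≃ {b : B // b ∈ U} × F,
      IsDiffeo e ∧ ∀ x, ((e x).1 : B) = p x

end SmoothStructure

/-! ### The `n`-dimensional Chaplygin ball, `n = d + 1` -/

namespace Chaplygin

variable (d : ℕ)

/-- The group `S = SO(n)`. -/
abbrev SO : Type := Matrix.specialOrthogonalGroup (Fin (d + 1)) ℝ

/-- The Lie algebra `so(n)` of skew-symmetric matrices. -/
abbrev so : Type := LieAlgebra.Orthogonal.so (Fin (d + 1)) ℝ

/-- The last standard basis vector `e_n`. -/
def eLast : Fin (d + 1) → ℝ := Pi.single (Fin.last d) 1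

/-- The subgroup `H = {h ∈ S : h e_n = e_n}`. -/
def H : Subgroup (SO d) where
  carrier := {h | h.1 *ᵥ eLast d = eLast d}
  one_mem' := by simp
  mul_mem' {a b} ha hb := by
    simp only [Set.mem_ofPred_eq] at ha hb ⊢
    rw [Submonoid.coe_mul, ← Matrix.mulVec_mulVec, hb, ha]
  inv_mem' {a} ha := by
    simp only [Set.mem_ofPred_eq] at ha ⊢
    have h1 : (a⁻¹).1 * a.1 = 1 := by rw [← Submonoid.coe_mul, inv_mul_cancel]; rfl
    conv_lhs => rw [← ha]
    rw [Matrix.mulVec_mulVec, h1, Matrix.one_mulVec]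

/-- The Lie algebra `𝔥 = {Y ∈ so(n) : Y e_n = 0}` of `H`. -/
def LieH : Submodule ℝ (so d) where
  carrier := {Y | Y.1 *ᵥ eLast d = 0}
  zero_mem' := by simp
  add_mem' {a b} ha hb := by
    simp only [Set.mem_ofPred_eq] at ha hb ⊢
    simp [Matrix.add_mulVec, ha, hb]
  smul_mem' c a ha := by
    simp only [Set.mem_ofPred_eq] at ha ⊢
    simp [Matrix.smul_mulVec, ha]

/-- The dual `𝔥*`. -/
abbrev DualH : Type := Module.Dual ℝ (LieH d)

variable {d}

theorem coe_inv (s : SO d) : (s⁻¹).1 = s.1ᵀ := by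
  rfl

/-- The adjoint action `Ad(s) u = s u s⁻¹` of `SO(n)` on `so(n)`. -/
def Ad (s : SO d) : so d →ₗ[ℝ] so d where
  toFun u := ⟨s.1 * u.1 * (s⁻¹).1, by
    have hu := (LieAlgebra.Orthogonal.mem_so (Fin (d + 1)) ℝ u.1).1 u.2
    rw [LieAlgebra.Orthogonal.mem_so, coe_inv]
    simp [Matrix.transpose_mul, hu, Matrix.mul_assoc]⟩
  map_add' u v := by
    apply Subtype.ext; simp [Matrix.mul_add, Matrix.add_mul]
  map_smul' c u := by
    apply Subtype.ext; simp

theorem Ad_mul (s t : SO d) (u : so d) : Ad (s * t) u = Ad s (Ad t u) := by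
  apply Subtype.ext
  simp [Ad, Matrix.mul_assoc]

theorem Ad_one (u : so d) : Ad (1 : SO d) u = u := by
  apply Subtype.ext
  simp [Ad]

/-- The adjoint action of `H` on `𝔥`. -/
def AdH (h : H d) : LieH d →ₗ[ℝ] LieH d :=
  (Ad h.1).restrict fun Y hY => by
    have h1 : (h.1⁻¹).1 *ᵥ eLast d = eLast d := (H d).inv_mem h.2
    have h2 : Y.1 *ᵥ eLast d = 0 := hY
    change (h.1.1 * Y.1 * (h.1⁻¹).1) *ᵥ eLast d = 0
    rw [← Matrix.mulVec_mulVec, h1, ← Matrix.mulVec_mulVec, h2, Matrix.mulVec_zero]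

/-- The coadjoint action `(h • ν)(Y) = ν (Ad(h⁻¹) Y)` of `H` on `𝔥*`. -/
instance : MulAction (H d) (DualH d) where
  smul h ν := ν ∘ₗ AdH h⁻¹
  one_smul ν := by
    ext Y
    change ν (AdH (1 : H d)⁻¹ Y) = ν Y
    congr 1; apply Subtype.ext
    change Ad ((1 : H d)⁻¹ : H d).1 Y.1 = Y.1
    simp [Ad_one]
  mul_smul g h ν := by
    ext Y
    change ν (AdH (g * h)⁻¹ Y) = ν (AdH h⁻¹ (AdH g⁻¹ Y))
    congr 1; apply Subtype.ext
    change Ad ((g * h)⁻¹ : H d).1 Y.1 = Ad (h⁻¹ : H d).1 (Ad (g⁻¹ : H d).1 Y.1)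
    rw [← Ad_mul]; simp

variable (d) in
/-- The tangent bundle `TS = S × so(n)` in the left trivialization: `(s, u)` stands for the tangent
vector `s u` at `s`. -/
@[ext] structure TS where
  /-- the base point -/
  base : SO d
  /-- the velocity in the body frame -/
  vel : so d

instance : DiffeologicalSpace (TS d) :=
  SmoothStructure.induced fun p : TS d => (p.base, p.vel)

/-- The tangent lift of the action of `H` on `S` by left multiplication. -/
instance : MulAction (H d) (TS d) where
  smul h p := ⟨h.1 * p.base, p.vel⟩
  one_smul p := by
    apply TS.ext
    · exact one_mul p.base
    · rfl
  mul_smul g h p := by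
    apply TS.ext
    · exact mul_assoc g.1 h.1 p.base
    · rfl

/-- The `Ad`-invariant inner product on `so(n)`: the Killing form, normalized to
`⟨u, v⟩ = - tr (u v) / 2`. -/
noncomputable def killing : LinearMap.BilinForm ℝ (so d) :=
  LinearMap.mk₂ ℝ (fun u v => -(1 / 2) * Matrix.trace (u.1 * v.1))
    (fun u u' v => by simp [Matrix.add_mul]; ring)
    (fun c u v => by simp; ring)
    (fun u v v' => by simp [Matrix.mul_add]; ring)
    (fun c u v => by simp; ring)

variable (d) in
/-- An inertia tensor: a symmetric positive definite endomorphism of `so(n)`. -/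
structure InertiaTensor where
  /-- the underlying linear map -/
  map : so d →ₗ[ℝ] so d
  symm : ∀ u v, killing (map u) v = killing u (map v)
  pos : ∀ u, u ≠ 0 → 0 < killing (map u) u

/-- The constraint form `𝒜 : TS → ℝⁿ⁻¹` in the left trivialization:
`𝒜_s(u) = -∑ₐ ⟨e_a, (Ad(s) u) e_n⟩ e_a`. The constraints of rolling without slipping are
`x' = -𝒜_s(u)`. -/
def constraintForm (s : SO d) : so d →ₗ[ℝ] (Fin d → ℝ) where
  toFun u a := -((Ad s u).1 *ᵥ eLast d) a.castSucc
  map_add' u v := by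
    ext a; simp [Matrix.add_mulVec]; ring
  map_smul' c u := by
    ext a; simp [Matrix.smul_mulVec]

/-- The kinetic energy metric `μ = ⟨𝕀 ·, ·⟩ + ⟨·, ·⟩_E` of `Q = S × ℝⁿ⁻¹`, on the tangent space
`so(n) × ℝⁿ⁻¹`. -/
noncomputable def kineticMetric (I : InertiaTensor d) (w w' : so d × (Fin d → ℝ)) : ℝ :=
  killing (I.map w.1) w'.1 + w.2 ⬝ᵥ w'.2

/-- The horizontal lift to `Q` of `(s, u)`: the vector of the constraint distribution over it. -/
def constraintLift (s : SO d) (u : so d) : so d × (Fin d → ℝ) := (u, -constraintForm s u)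

/-- The induced metric `μ₀` on `S`, for which the constraint distribution projects isometrically
to `TS`. -/
noncomputable def mu0 (I : InertiaTensor d) (s : SO d) : LinearMap.BilinForm ℝ (so d) :=
  LinearMap.mk₂ ℝ (fun u v => kineticMetric I (constraintLift s u) (constraintLift s v))
    (fun u u' v => by simp [kineticMetric, constraintLift]; ring)
    (fun c u v => by simp [kineticMetric, constraintLift]; ring)
    (fun u v v' => by simp [kineticMetric, constraintLift]; ring)
    (fun c u v => by simp [kineticMetric, constraintLift]; ring)

/-- The infinitesimal generator `ζ_Y(s) = Ad(s⁻¹) Y` of the action of `H` on `S` by left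
multiplication, in the left trivialization. -/
def generator (s : SO d) : LieH d →ₗ[ℝ] so d := Ad s⁻¹ ∘ₗ (LieH d).subtype

/-- The momentum map `J_H : TS = T*S → 𝔥*` (identification through `μ₀`):
`⟨J_H(s, u), Y⟩ = μ₀(u, ζ_Y(s))`. -/
noncomputable def momentum (I : InertiaTensor d) (p : TS d) : DualH d :=
  mu0 I p.base p.vel ∘ₗ generator p.base

/-- The locked inertia tensor `𝕃(s) : 𝔥 → 𝔥*`, `⟨𝕃(s) Y, Y'⟩ = μ₀(ζ_Y(s), ζ_Y'(s))`. -/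
noncomputable def lockedInertiaMap (I : InertiaTensor d) (s : SO d) : LieH d →ₗ[ℝ] DualH d :=
  (mu0 I s).compl₁₂ (generator s) (generator s)

theorem generator_injective (s : SO d) : Function.Injective (generator s) := by
  intro Y Y' h
  have h1 : Ad s⁻¹ Y.1 = Ad s⁻¹ Y'.1 := h
  apply Subtype.ext
  have h2 := congrArg (Ad s) h1
  rwa [← Ad_mul, ← Ad_mul, mul_inv_cancel, Ad_one, Ad_one] at h2

theorem lockedInertiaMap_injective (I : InertiaTensor d) (s : SO d) :
    Function.Injective (lockedInertiaMap I s) := by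
  rw [← LinearMap.ker_eq_bot, LinearMap.ker_eq_bot']
  intro Y hY
  by_contra hne
  have h0 : generator s Y ≠ 0 := fun h => hne (generator_injective s (by rw [h, map_zero]))
  have h1 : lockedInertiaMap I s Y Y = 0 := by rw [hY]; rfl
  have h2 : 0 < killing (I.map (generator s Y)) (generator s Y) := I.pos _ h0
  have h3 : (0 : ℝ) ≤ constraintForm s (generator s Y) ⬝ᵥ constraintForm s (generator s Y) :=
    Finset.sum_nonneg fun i _ => mul_self_nonneg _
  have h4 : lockedInertiaMap I s Y Y = killing (I.map (generator s Y)) (generator s Y) +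
      constraintForm s (generator s Y) ⬝ᵥ constraintForm s (generator s Y) := by
    simp [lockedInertiaMap, mu0, kineticMetric, constraintLift]
  linarith

/-- The locked inertia tensor as an isomorphism `𝔥 ≅ 𝔥*`. -/
noncomputable def lockedInertia (I : InertiaTensor d) (s : SO d) : LieH d ≃ₗ[ℝ] DualH d :=
  (lockedInertiaMap I s).linearEquivOfInjective (lockedInertiaMap_injective I s)
    Subspace.dual_finrank_eq.symm

/-- The connection form `TS → 𝔥` of the mechanical connection on `S → S/H` associated to `μ₀`:
`(s, u) ↦ 𝕃(s)⁻¹ J_H(s, u)`. Its kernel is the `μ₀`-orthogonal complement of the vertical space. -/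
noncomputable def mechanicalConnection (I : InertiaTensor d) (p : TS d) : LieH d :=
  (lockedInertia I p.base).symm (momentum I p)

variable (d) in
/-- The tangent bundle of the sphere `Sⁿ⁻¹ ⊂ ℝⁿ`: the pairs `(x, v)` with `|x| = 1`, `v ⊥ x`. -/
abbrev TSphere : Type :=
  {z : EuclideanSpace ℝ (Fin (d + 1)) × EuclideanSpace ℝ (Fin (d + 1)) //
    ‖z.1‖ = 1 ∧ inner ℝ z.1 z.2 = 0}

/-- The projection `κ : S → S/H = Sⁿ⁻¹`, `s ↦ s⁻¹ e_n`, as a map to `ℝⁿ`. -/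
def proj (s : SO d) : EuclideanSpace ℝ (Fin (d + 1)) := WithLp.toLp 2 ((s⁻¹).1 *ᵥ eLast d)

theorem norm_proj (s : SO d) : ‖proj s‖ = 1 := by
  have h1 : (s.1ᵀ *ᵥ eLast d) ⬝ᵥ (s.1ᵀ *ᵥ eLast d) = 1 := by
    have hs : s.1 * s.1ᵀ = 1 := by
      rw [← coe_inv, ← Submonoid.coe_mul, mul_inv_cancel]; rfl
    rw [Matrix.dotProduct_mulVec, Matrix.vecMul_transpose, Matrix.mulVec_mulVec, hs,
      Matrix.one_mulVec]
    simp [eLast]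
  have h2 : ‖proj s‖ ^ 2 = 1 := by
    rw [← h1, EuclideanSpace.norm_sq_eq]
    simp [proj, dotProduct, coe_inv, sq]
  nlinarith [norm_nonneg (proj s)]

/-- The tangent map `Tκ : TS → TSⁿ⁻¹`. As `κ(s exp(tu)) = exp(-tu) s⁻¹ e_n`, it sends `(s, u)` to
`(κ(s), -u κ(s))`. -/
def tangentProj (p : TS d) : TSphere d :=
  ⟨(proj p.base, WithLp.toLp 2 (-(p.vel.1 *ᵥ (proj p.base).ofLp))), norm_proj _, by
    have hu := (LieAlgebra.Orthogonal.mem_so (Fin (d + 1)) ℝ p.vel.1).1 p.vel.2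
    set x := (proj p.base).ofLp with hx
    have h1 : x ⬝ᵥ (p.vel.1 *ᵥ x) = -(x ⬝ᵥ (p.vel.1 *ᵥ x)) := by
      conv_lhs => rw [Matrix.dotProduct_mulVec, ← Matrix.mulVec_transpose, hu, Matrix.neg_mulVec,
        neg_dotProduct, dotProduct_comm]
    have h2 : x ⬝ᵥ (p.vel.1 *ᵥ x) = 0 := by linarith
    rw [EuclideanSpace.inner_eq_star_dotProduct]
    simp [← hx, dotProduct_comm, h2]⟩

/-- The level set `J_H⁻¹(𝒪)`. -/
abbrev MomentumLevel (I : InertiaTensor d) (O : Set (DualH d)) : Type :=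
  {p : TS d // momentum I p ∈ O}

/-- The reduced space `J_H⁻¹(𝒪)/H`. -/
abbrev ReducedSpace (I : InertiaTensor d) (O : Set (DualH d)) : Type :=
  Quotient ((MulAction.orbitRel (H d) (TS d)).comap
    (Subtype.val : MomentumLevel I O → TS d))

/-- The class in `J_H⁻¹(𝒪)/H` of a point of `J_H⁻¹(𝒪)`. -/
def ReducedSpace.mk {I : InertiaTensor d} {O : Set (DualH d)} (p : TS d)
    (hp : momentum I p ∈ O) : ReducedSpace I O :=
  Quotient.mk _ ⟨p, hp⟩

/-- The associated bundle `S ×_H 𝒪`, the quotient of `S × 𝒪` by `h (s, ν) = (h s, h ν)`. -/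
abbrev AssociatedBundle (O : Set (DualH d)) : Type :=
  Quotient ((MulAction.orbitRel (H d) (SO d × DualH d)).comap
    (fun x : SO d × {ν : DualH d // ν ∈ O} => (x.1, x.2.1)))

/-- The class `[s, ν]` in `S ×_H 𝒪`. -/
def AssociatedBundle.mk {O : Set (DualH d)} (s : SO d) (ν : {ν : DualH d // ν ∈ O}) :
    AssociatedBundle O :=
  Quotient.mk _ (s, ν)

theorem proj_smul (h : H d) (s : SO d) : proj (h • s) = proj s := by
  have h1 : (h.1⁻¹).1 *ᵥ eLast d = eLast d := (H d).inv_mem h.2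
  change proj (h.1 * s) = proj s
  unfold proj
  rw [mul_inv_rev, Submonoid.coe_mul, ← Matrix.mulVec_mulVec, h1]

/-- The bundle projection `S ×_H 𝒪 → Sⁿ⁻¹`, `[s, ν] ↦ κ(s)`. -/
def AssociatedBundle.proj {O : Set (DualH d)} (z : AssociatedBundle O) :
    EuclideanSpace ℝ (Fin (d + 1)) :=
  Quotient.lift (fun x : SO d × {ν : DualH d // ν ∈ O} => Chaplygin.proj x.1)
    (by
      rintro ⟨s, ν⟩ ⟨t, ξ⟩ ⟨h, hh⟩
      have h1 : h • t = s := congrArg Prod.fst hh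
      change Chaplygin.proj s = Chaplygin.proj t
      rw [← h1, proj_smul]) z

/-- The fibre product `TSⁿ⁻¹ ×_{Sⁿ⁻¹} (S ×_H 𝒪)`. -/
abbrev FiberProduct (O : Set (DualH d)) : Type :=
  {z : TSphere d × AssociatedBundle O // z.1.1.1 = z.2.proj}

end Chaplygin

namespace Chaplygin

variable {d : ℕ}

/-! ### Momentum map and mechanical connection -/

/-! At a fixed `s`, the kernel of `Tκ` is the vertical space `{ζ_Y(s)}`, and on it `J_H` is the
locked inertia tensor, an isomorphism `𝔥 ≅ 𝔥*`. Hence `u ↦ (Tκ(s, u), J_H(s, u))` is a bijection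
onto the tangent vectors at `κ(s)` times `𝔥*` (`eq_of_tangentProj_eq_of_momentum_eq`,
`tangentProj_withMomentum`, `momentum_withMomentum`). Since `Tκ` is `H`-invariant and `J_H` is
equivariant, it descends to `Φ`. The inverse takes any lift of `(x, v)`, here `wedge x v`, and adds
the vertical vector that makes the momentum `ν`; for `ν = 0` this is the horizontal lift.

Smoothness: the constraint form vanishes on vertical vectors, so `J_H` is polynomial in the entries
of `s` and linear in `u`, and `𝕃(s)⁻¹` is smooth by Cramer's rule
(`matrixSmoothAt_lockedInertia_symm`).

Local triviality: away from an auxiliary unit vector `a ≠ e_n`, a product of two Householder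
reflections is a smooth section of `κ`. The `H`-action does not change the body velocity, so a class
`[s, u]` has a representative `(σ(κ(s)), u)` on the section `σ`, and its momentum is the fibre
coordinate. -/

theorem coe_mul_transpose (s : SO d) : s.1 * s.1ᵀ = 1 := by
  rw [← coe_inv, ← Submonoid.coe_mul, mul_inv_cancel]; rfl

theorem coe_Ad_inv (s : SO d) (u : so d) : (Ad s⁻¹ u).1 = s.1ᵀ * u.1 * s.1 := by
  change (s⁻¹).1 * u.1 * (s⁻¹⁻¹).1 = _
  rw [inv_inv, coe_inv]

/-- `Ad(s)` undoes `Ad(s⁻¹)`, leaving `Y e_n = 0`: spinning about the contact normal does not move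
the ball. -/
theorem constraintForm_generator (s : SO d) (Y : LieH d) :
    constraintForm s (generator s Y) = 0 := by
  have h : Y.1.1 *ᵥ eLast d = 0 := Y.2
  ext a
  change -((Ad s (Ad s⁻¹ Y.1)).1 *ᵥ eLast d) a.castSucc = 0
  rw [← Ad_mul, mul_inv_cancel, Ad_one, h]
  simp

/-- The momentum `Y ↦ ⟨𝕀 u, Aᵀ Y A⟩`, for an arbitrary matrix `A` in place of a rotation. -/
noncomputable def matrixMomentum (I : InertiaTensor d) (A : Matrix (Fin (d + 1)) (Fin (d + 1)) ℝ)
    (u : so d) : DualH d where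
  toFun Y := -(1 / 2) * Matrix.trace ((I.map u).1 * (Aᵀ * Y.1.1 * A))
  map_add' Y Y' := by simp [Matrix.mul_add, Matrix.add_mul]; ring
  map_smul' c Y := by simp; ring

/-- The constraint part of `μ₀` is paired with a generator and drops out. What remains is polynomial
in the entries of the rotation, which gives smoothness. -/
theorem momentum_eq_matrixMomentum (I : InertiaTensor d) (p : TS d) :
    momentum I p = matrixMomentum I p.base.1 p.vel := by
  ext Y
  change killing (I.map p.vel) (generator p.base Y) +
    (-constraintForm p.base p.vel) ⬝ᵥ (-constraintForm p.base (generator p.base Y)) = _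
  rw [constraintForm_generator, neg_zero, dotProduct_zero, add_zero]
  change -(1 / 2) * Matrix.trace ((I.map p.vel).1 * (Ad p.base⁻¹ Y.1).1) = _
  rw [coe_Ad_inv]
  rfl

theorem matrixMomentum_smul (I : InertiaTensor d) (h : H d)
    (A : Matrix (Fin (d + 1)) (Fin (d + 1)) ℝ) (u : so d) :
    matrixMomentum I (h.1.1 * A) u = h • matrixMomentum I A u := by
  ext Y
  change -(1 / 2) * Matrix.trace ((I.map u).1 * ((h.1.1 * A)ᵀ * Y.1.1 * (h.1.1 * A))) =
    -(1 / 2) * Matrix.trace ((I.map u).1 * (Aᵀ * (Ad h.1⁻¹ Y.1).1 * A))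
  rw [coe_Ad_inv, Matrix.transpose_mul]
  simp only [Matrix.mul_assoc]

theorem momentum_smul (I : InertiaTensor d) (h : H d) (p : TS d) :
    momentum I (h • p) = h • momentum I p := by
  rw [momentum_eq_matrixMomentum, momentum_eq_matrixMomentum, ← matrixMomentum_smul]
  rfl

theorem momentum_add (I : InertiaTensor d) (s : SO d) (u v : so d) :
    momentum I ⟨s, u + v⟩ = momentum I ⟨s, u⟩ + momentum I ⟨s, v⟩ := by
  change mu0 I s (u + v) ∘ₗ generator s = mu0 I s u ∘ₗ generator s + mu0 I s v ∘ₗ generator s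
  rw [map_add, LinearMap.add_comp]

theorem momentum_generator (I : InertiaTensor d) (s : SO d) (Y : LieH d) :
    momentum I ⟨s, generator s Y⟩ = lockedInertia I s Y := rfl

/-- The vector at `s` with momentum `ν` that differs from `w` by a vertical vector. -/
noncomputable def withMomentum (I : InertiaTensor d) (s : SO d) (w : so d) (ν : DualH d) : so d :=
  w + generator s ((lockedInertia I s).symm (ν - momentum I ⟨s, w⟩))

theorem momentum_withMomentum (I : InertiaTensor d) (s : SO d) (w : so d) (ν : DualH d) :
    momentum I ⟨s, withMomentum I s w ν⟩ = ν := by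
  rw [withMomentum, momentum_add, momentum_generator, LinearEquiv.apply_symm_apply]
  abel

theorem proj_ofLp (s : SO d) : (proj s).ofLp = s.1ᵀ *ᵥ eLast d := rfl

theorem generator_mulVec_proj (s : SO d) (Y : LieH d) :
    (generator s Y).1 *ᵥ (proj s).ofLp = 0 := by
  have h : Y.1.1 *ᵥ eLast d = 0 := Y.2
  change (Ad s⁻¹ Y.1).1 *ᵥ _ = 0
  rw [coe_Ad_inv, proj_ofLp, Matrix.mulVec_mulVec, Matrix.mul_assoc, coe_mul_transpose,
    Matrix.mul_one, ← Matrix.mulVec_mulVec, h, Matrix.mulVec_zero]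

/-- The kernel of `Tκ` is vertical: `Ad(s) u` kills `e_n` because `s⁻¹ e_n = κ(s)`. -/
theorem exists_generator_eq {s : SO d} {u : so d} (h : u.1 *ᵥ (proj s).ofLp = 0) :
    ∃ Y, generator s Y = u := by
  refine ⟨⟨Ad s u, ?_⟩, ?_⟩
  · change (s.1 * u.1 * (s⁻¹).1) *ᵥ eLast d = 0
    rw [coe_inv, Matrix.mul_assoc, ← Matrix.mulVec_mulVec, ← Matrix.mulVec_mulVec, ← proj_ofLp, h,
      Matrix.mulVec_zero]
  · change Ad s⁻¹ (Ad s u) = u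
    rw [← Ad_mul, inv_mul_cancel, Ad_one]

theorem tangentProj_eq_iff {s : SO d} {u v : so d} :
    tangentProj ⟨s, u⟩ = tangentProj ⟨s, v⟩ ↔ u.1 *ᵥ (proj s).ofLp = v.1 *ᵥ (proj s).ofLp := by
  rw [Subtype.ext_iff, Prod.ext_iff]
  simp [tangentProj]

theorem tangentProj_add_generator (s : SO d) (u : so d) (Y : LieH d) :
    tangentProj ⟨s, u + generator s Y⟩ = tangentProj ⟨s, u⟩ := by
  rw [tangentProj_eq_iff]
  change (u.1 + (generator s Y).1) *ᵥ _ = _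
  rw [Matrix.add_mulVec, generator_mulVec_proj, add_zero]

/-- The difference is vertical, and the momentum of a vertical vector determines it because `𝕃(s)`
is injective. -/
theorem eq_of_tangentProj_eq_of_momentum_eq {I : InertiaTensor d} {s : SO d} {u v : so d}
    (h : tangentProj ⟨s, u⟩ = tangentProj ⟨s, v⟩) (hJ : momentum I ⟨s, u⟩ = momentum I ⟨s, v⟩) :
    u = v := by
  obtain ⟨Y, hY⟩ : ∃ Y, generator s Y = u - v := by
    apply exists_generator_eq
    change (u.1 - v.1) *ᵥ _ = 0
    rw [Matrix.sub_mulVec, tangentProj_eq_iff.1 h, sub_self]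
  have hu : u = v + generator s Y := by rw [hY]; abel
  rw [hu, momentum_add, momentum_generator, add_eq_left, LinearEquiv.map_eq_zero_iff] at hJ
  rw [hu, hJ, map_zero, add_zero]

theorem tangentProj_smul (h : H d) (p : TS d) : tangentProj (h • p) = tangentProj p := by
  have h1 : proj (h • p).base = proj p.base := proj_smul h p.base
  apply Subtype.ext
  change (proj (h • p).base, WithLp.toLp 2 (-(p.vel.1 *ᵥ (proj (h • p).base).ofLp))) =
    (proj p.base, WithLp.toLp 2 (-(p.vel.1 *ᵥ (proj p.base).ofLp)))
  rw [h1]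

/-- The skew-symmetric matrix `x vᵀ - v xᵀ`. -/
def wedge (x v : EuclideanSpace ℝ (Fin (d + 1))) : so d :=
  ⟨Matrix.vecMulVec x.ofLp v.ofLp - Matrix.vecMulVec v.ofLp x.ofLp, by
    rw [LieAlgebra.Orthogonal.mem_so, Matrix.transpose_sub, Matrix.transpose_vecMulVec,
      Matrix.transpose_vecMulVec, neg_sub]⟩

/-- With `|x| = 1` and `v ⊥ x`, `(x vᵀ - v xᵀ) x = -v`, and the sign cancels that of `Tκ`. The lift
depends smoothly on `(x, v)` but need not be horizontal. -/
theorem tangentProj_wedge (z : TSphere d) {s : SO d} (h : proj s = z.1.1) :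
    tangentProj ⟨s, wedge z.1.1 z.1.2⟩ = z := by
  have h1 : z.1.1.ofLp ⬝ᵥ z.1.1.ofLp = 1 := by
    have := EuclideanSpace.norm_sq_eq z.1.1
    rw [z.2.1] at this
    simpa [dotProduct, sq] using this.symm
  have h2 : z.1.2.ofLp ⬝ᵥ z.1.1.ofLp = 0 := by
    have := z.2.2
    rw [EuclideanSpace.inner_eq_star_dotProduct] at this
    simpa using this
  apply Subtype.ext
  refine Prod.ext h ?_
  change WithLp.toLp 2 (-((Matrix.vecMulVec z.1.1.ofLp z.1.2.ofLp -
    Matrix.vecMulVec z.1.2.ofLp z.1.1.ofLp) *ᵥ (proj s).ofLp)) = z.1.2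
  rw [h, Matrix.sub_mulVec, Matrix.vecMulVec_mulVec, Matrix.vecMulVec_mulVec, h1, h2]
  simp

theorem tangentProj_withMomentum (I : InertiaTensor d) (z : TSphere d) {s : SO d}
    (h : proj s = z.1.1) (ν : DualH d) :
    tangentProj ⟨s, withMomentum I s (wedge z.1.1 z.1.2) ν⟩ = z := by
  rw [withMomentum, tangentProj_add_generator, tangentProj_wedge z h]

theorem mechanicalConnection_eq_zero_iff {I : InertiaTensor d} {p : TS d} :
    mechanicalConnection I p = 0 ↔ momentum I p = 0 :=
  LinearEquiv.map_eq_zero_iff _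

/-! ### The reduced space as a fibre product -/

variable {O : Set (DualH d)}

theorem ReducedSpace.mk_eq_iff {I : InertiaTensor d} {p q : TS d} {hp : momentum I p ∈ O}
    {hq : momentum I q ∈ O} :
    (ReducedSpace.mk p hp : ReducedSpace I O) = ReducedSpace.mk q hq ↔ ∃ h : H d, h • q = p :=
  Quotient.eq

theorem AssociatedBundle.mk_eq_iff {s t : SO d} {ν ξ : {ν : DualH d // ν ∈ O}} :
    (AssociatedBundle.mk s ν : AssociatedBundle O) = AssociatedBundle.mk t ξ ↔
      ∃ h : H d, h • t = s ∧ h • ξ.1 = ν.1 := by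
  refine Quotient.eq.trans (exists_congr fun h => ?_)
  exact Prod.ext_iff

/-- The map `[s, u] ↦ (Tκ(s, u), [s, J_H(s, u)])`. -/
noncomputable def reducedMap (I : InertiaTensor d) (O : Set (DualH d)) :
    ReducedSpace I O → FiberProduct O :=
  Quotient.lift (fun p : MomentumLevel I O => ⟨(tangentProj p.1,
    AssociatedBundle.mk p.1.base ⟨momentum I p.1, p.2⟩), rfl⟩) (by
      rintro ⟨p, hp⟩ ⟨q, hq⟩ ⟨h, hh⟩
      have hh : h • q = p := hh
      subst hh
      refine Subtype.ext (Prod.ext (tangentProj_smul h q) ?_)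
      exact AssociatedBundle.mk_eq_iff.2 ⟨h, rfl, (momentum_smul I h q).symm⟩)

theorem reducedMap_mk (I : InertiaTensor d) (p : TS d) (hp : momentum I p ∈ O) :
    (reducedMap I O (ReducedSpace.mk p hp)).1 =
      (tangentProj p, AssociatedBundle.mk p.base ⟨momentum I p, hp⟩) := rfl

theorem reducedMap_injective (I : InertiaTensor d) (O : Set (DualH d)) :
    Function.Injective (reducedMap I O) := by
  rintro ⟨⟨p, hp⟩⟩ ⟨⟨q, hq⟩⟩ hpq
  obtain ⟨h1, h2⟩ := Prod.ext_iff.1 (Subtype.ext_iff.1 hpq)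
  obtain ⟨h, hb, hν⟩ := AssociatedBundle.mk_eq_iff.1 h2
  refine ReducedSpace.mk_eq_iff.2 ⟨h, ?_⟩
  have h1 : tangentProj p = tangentProj q := h1
  -- Moving the second point by `h` gives both the same base point, where tangent projection and
  -- momentum determine the velocity.
  rw [← tangentProj_smul h q] at h1
  have hν : h • momentum I q = momentum I p := hν
  rw [← momentum_smul] at hν
  obtain ⟨s, u⟩ := p
  obtain ⟨t, v⟩ := q
  have hb : h • t = s := hb
  subst hb
  refine TS.ext rfl ?_
  exact (eq_of_tangentProj_eq_of_momentum_eq h1 hν.symm).symm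

theorem proj_eq_of_mk_eq {z : FiberProduct O} {s : SO d} {ν : {ν : DualH d // ν ∈ O}}
    (h : z.1.2 = AssociatedBundle.mk s ν) : proj s = z.1.1.1.1 := by
  rw [z.2, h]; rfl

theorem reducedMap_withMomentum (I : InertiaTensor d) {z : FiberProduct O} {s : SO d}
    {ν : {ν : DualH d // ν ∈ O}} (h : z.1.2 = AssociatedBundle.mk s ν)
    (hJ : momentum I ⟨s, withMomentum I s (wedge z.1.1.1.1 z.1.1.1.2) ν.1⟩ ∈ O) :
    reducedMap I O (ReducedSpace.mk _ hJ) = z := by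
  apply Subtype.ext
  rw [reducedMap_mk]
  refine Prod.ext (tangentProj_withMomentum I z.1.1 (proj_eq_of_mk_eq h) ν.1) ?_
  rw [h]
  exact congrArg (AssociatedBundle.mk s) (Subtype.ext (momentum_withMomentum I s _ ν.1))

theorem withMomentum_mem (I : InertiaTensor d) (s : SO d) (w : so d)
    (ν : {ν : DualH d // ν ∈ O}) : momentum I ⟨s, withMomentum I s w ν.1⟩ ∈ O := by
  rw [momentum_withMomentum]; exact ν.2

theorem reducedMap_surjective (I : InertiaTensor d) (O : Set (DualH d)) :
    Function.Surjective (reducedMap I O) := by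
  intro z
  obtain ⟨⟨s, ν⟩, h⟩ := Quotient.exists_rep z.1.2
  exact ⟨_, reducedMap_withMomentum I h.symm (withMomentum_mem I s _ ν)⟩

/-- The bijection `J_H⁻¹(𝒪)/H ≃ TSⁿ⁻¹ ×_{Sⁿ⁻¹} (S ×_H 𝒪)`. -/
noncomputable def reducedEquiv (I : InertiaTensor d) (O : Set (DualH d)) :
    ReducedSpace I O ≃ FiberProduct O :=
  Equiv.ofBijective _ ⟨reducedMap_injective I O, reducedMap_surjective I O⟩

theorem reducedEquiv_symm_eq (I : InertiaTensor d) {z : FiberProduct O} {s : SO d}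
    {ν : {ν : DualH d // ν ∈ O}} (h : z.1.2 = AssociatedBundle.mk s ν) :
    (reducedEquiv I O).symm z =
      ReducedSpace.mk _ (withMomentum_mem I s (wedge z.1.1.1.1 z.1.1.1.2) ν) :=
  (Equiv.symm_apply_eq _).2 (reducedMap_withMomentum I h _).symm

theorem exists_horizontal_lift (I : InertiaTensor d) (z : FiberProduct O) (s : SO d)
    (ν : {ν : DualH d // ν ∈ O}) (h : z.1.2 = AssociatedBundle.mk s ν) :
    ∃ u : so d,
      (∀ w : so d, (mechanicalConnection I ⟨s, w⟩ = 0 ∧ tangentProj ⟨s, w⟩ = z.1.1) ↔ w = u) ∧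
      ∃ hJ : momentum I ⟨s, u + generator s ((lockedInertia I s).symm ν.1)⟩ ∈ O,
        (reducedEquiv I O).symm z = ReducedSpace.mk _ hJ := by
  have hs := proj_eq_of_mk_eq h
  have ht := tangentProj_withMomentum I z.1.1 hs 0
  have h0 := momentum_withMomentum I s (wedge z.1.1.1.1 z.1.1.1.2) 0
  -- The vertical correction is affine in the prescribed momentum, so passing from `0` to `ν` adds
  -- exactly `ζ_{𝕃(s)⁻¹ν}(s)`.
  have heq : withMomentum I s (wedge z.1.1.1.1 z.1.1.1.2) 0 +
      generator s ((lockedInertia I s).symm ν.1) =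
        withMomentum I s (wedge z.1.1.1.1 z.1.1.1.2) ν.1 := by
    rw [withMomentum, withMomentum, zero_sub, sub_eq_add_neg, map_add, map_add]
    abel
  refine ⟨withMomentum I s (wedge z.1.1.1.1 z.1.1.1.2) 0, fun w => ?_, ?_⟩
  · rw [mechanicalConnection_eq_zero_iff]
    constructor
    · rintro ⟨hw, hw'⟩
      exact eq_of_tangentProj_eq_of_momentum_eq (hw'.trans ht.symm) (hw.trans h0.symm)
    · rintro rfl
      exact ⟨h0, ht⟩
  · rw [heq]
    exact ⟨withMomentum_mem I s _ ν, reducedEquiv_symm_eq I h⟩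

end Chaplygin

/-! ### Matrix-valued smooth maps -/

section MatrixSmooth

variable {E : Type*} [NormedAddCommGroup E] [NormedSpace ℝ E]
  {l m n : Type*} {f g : E → Matrix m n ℝ} {x : E}

/-- The entries of the matrix-valued map `f` are smooth at `x`. -/
def MatrixSmoothAt (f : E → Matrix m n ℝ) (x : E) : Prop :=
  ∀ i j, ContDiffAt ℝ ∞ (fun y => f y i j) x

theorem MatrixSmoothAt.const (A : Matrix m n ℝ) : MatrixSmoothAt (fun _ => A) x :=
  fun _ _ => contDiffAt_const

theorem MatrixSmoothAt.add (hf : MatrixSmoothAt f x) (hg : MatrixSmoothAt g x) :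
    MatrixSmoothAt (fun y => f y + g y) x :=
  fun i j => (hf i j).add (hg i j)

theorem MatrixSmoothAt.sub (hf : MatrixSmoothAt f x) (hg : MatrixSmoothAt g x) :
    MatrixSmoothAt (fun y => f y - g y) x :=
  fun i j => (hf i j).sub (hg i j)

theorem MatrixSmoothAt.smul {c : E → ℝ} (hc : ContDiffAt ℝ ∞ c x) (hf : MatrixSmoothAt f x) :
    MatrixSmoothAt (fun y => c y • f y) x :=
  fun i j => hc.mul (hf i j)

theorem MatrixSmoothAt.transpose (hf : MatrixSmoothAt f x) : MatrixSmoothAt (fun y => (f y)ᵀ) x :=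
  fun i j => hf j i

theorem MatrixSmoothAt.mul [Fintype m] {f : E → Matrix l m ℝ} (hf : MatrixSmoothAt f x)
    (hg : MatrixSmoothAt g x) : MatrixSmoothAt (fun y => f y * g y) x :=
  fun i j => ContDiffAt.sum fun k _ => (hf i k).mul (hg k j)

theorem MatrixSmoothAt.vecMulVec {a : E → m → ℝ} {b : E → n → ℝ}
    (ha : ∀ i, ContDiffAt ℝ ∞ (fun y => a y i) x) (hb : ∀ j, ContDiffAt ℝ ∞ (fun y => b y j) x) :
    MatrixSmoothAt (fun y => Matrix.vecMulVec (a y) (b y)) x :=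
  fun i j => (ha i).mul (hb j)

theorem MatrixSmoothAt.mulVec [Fintype n] {b : E → n → ℝ} (hf : MatrixSmoothAt f x)
    (hb : ∀ j, ContDiffAt ℝ ∞ (fun y => b y j) x) (i : m) :
    ContDiffAt ℝ ∞ (fun y => (f y *ᵥ b y) i) x :=
  ContDiffAt.sum fun k _ => (hf i k).mul (hb k)

theorem MatrixSmoothAt.trace [Fintype m] {f : E → Matrix m m ℝ} (hf : MatrixSmoothAt f x) :
    ContDiffAt ℝ ∞ (fun y => (f y).trace) x :=
  ContDiffAt.sum fun i _ => hf i i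

theorem MatrixSmoothAt.det [Fintype m] [DecidableEq m] {f : E → Matrix m m ℝ}
    (hf : MatrixSmoothAt f x) : ContDiffAt ℝ ∞ (fun y => (f y).det) x := by
  simp_rw [Matrix.det_apply']
  exact ContDiffAt.sum fun σ _ => contDiffAt_const.mul (contDiffAt_prod fun i _ => hf _ _)

/-- Cramer's rule: each entry of the adjugate is the determinant of the matrix with one row replaced
by a constant vector. -/
theorem MatrixSmoothAt.inv [Fintype m] [DecidableEq m] {f : E → Matrix m m ℝ}
    (hf : MatrixSmoothAt f x) (h : (f x).det ≠ 0) : MatrixSmoothAt (fun y => (f y)⁻¹) x := by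
  simp_rw [Matrix.inv_def, Ring.inverse_eq_inv']
  refine .smul (hf.det.inv h) fun i j => ?_
  simp_rw [Matrix.adjugate_apply]
  refine MatrixSmoothAt.det fun a b => ?_
  by_cases ha : a = j
  · subst ha
    exact contDiffAt_const.congr_of_eventuallyEq
      (.of_forall fun _ => congrFun Matrix.updateRow_self b)
  · exact (hf a b).congr_of_eventuallyEq
      (.of_forall fun _ => congrFun (Matrix.updateRow_ne ha) b)

theorem MatrixSmoothAt.linearMap [Finite m] [Finite n] (hf : MatrixSmoothAt f x)
    (φ : Matrix m n ℝ →ₗ[ℝ] ℝ) : ContDiffAt ℝ ∞ (fun y => φ (f y)) x := by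
  classical
  have := Fintype.ofFinite m
  have := Fintype.ofFinite n
  have h : ∀ A : Matrix m n ℝ, φ A = ∑ i, ∑ j, A i j * φ (Matrix.single i j 1) := by
    intro A
    conv_lhs => rw [Matrix.matrix_eq_sum_single A]
    simp only [map_sum]
    refine Finset.sum_congr rfl fun i _ => Finset.sum_congr rfl fun j _ => ?_
    rw [← smul_eq_mul, ← map_smul, Matrix.smul_single, smul_eq_mul, mul_one]
  rw [funext fun y => h (f y)]
  exact ContDiffAt.sum fun i _ => ContDiffAt.sum fun j _ => (hf i j).mul contDiffAt_const

end MatrixSmooth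

/-! ### Plots of matrix spaces, duals, subsets, products and quotients -/

namespace SmoothStructure

variable {X Y : Type*} [DiffeologicalSpace X] [DiffeologicalSpace Y] {k : ℕ}

theorem isPlot_matrix_iff {m n : Type*} {p : EuclideanSpace ℝ (Fin k) → Matrix m n ℝ} :
    IsPlot p ↔ ∀ x, MatrixSmoothAt p x := by
  constructor
  · intro h x i j
    exact (isPlot_iff_contDiff.1 (h (i, j))).contDiffAt
  · intro h ij
    exact isPlot_iff_contDiff.2 (contDiff_iff_contDiffAt.2 fun x => h x ij.1 ij.2)

theorem isPlot_dual_iff {V : Type*} [AddCommGroup V] [Module ℝ V]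
    {p : EuclideanSpace ℝ (Fin k) → Module.Dual ℝ V} :
    IsPlot p ↔ ∀ x Y, ContDiffAt ℝ ∞ (fun y => p y Y) x := by
  constructor
  · intro h x Y
    exact (isPlot_iff_contDiff.1 (h Y)).contDiffAt
  · intro h Y
    exact isPlot_iff_contDiff.2 (contDiff_iff_contDiffAt.2 fun x => h x Y)

theorem isPlot_euclideanSpace_iff {ι : Type*} [Fintype ι]
    {p : EuclideanSpace ℝ (Fin k) → EuclideanSpace ℝ ι} :
    IsPlot p ↔ ∀ x i, ContDiffAt ℝ ∞ (fun y => p y i) x := by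
  rw [isPlot_iff_contDiff, contDiff_iff_contDiffAt]
  exact forall_congr' fun x => contDiffAt_euclidean

theorem isPlot_subtype_iff {P : X → Prop} {p : EuclideanSpace ℝ (Fin k) → {x // P x}} :
    IsPlot p ↔ IsPlot fun y => (p y).1 := Iff.rfl

theorem isPlot_prod_iff {p : EuclideanSpace ℝ (Fin k) → X × Y} :
    IsPlot p ↔ (IsPlot fun y => (p y).1) ∧ IsPlot fun y => (p y).2 := Iff.rfl

theorem isPlot_quotient_iff {r : Setoid X} {p : EuclideanSpace ℝ (Fin k) → Quotient r} :
    IsPlot p ↔ ∀ x, ∃ q : EuclideanSpace ℝ (Fin k) → X,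
      IsPlot q ∧ ∀ᶠ y in 𝓝 x, p y = Quotient.mk r (q y) := Iff.rfl

theorem isPlot_mk {r : Setoid X} {p : EuclideanSpace ℝ (Fin k) → X} (hp : IsPlot p) :
    IsPlot fun y => Quotient.mk r (p y) :=
  isPlot_quotient_iff.2 fun _ => ⟨p, hp, Filter.Eventually.of_forall fun _ => rfl⟩

theorem dSmooth_of_comp_mk {r : Setoid X} {f : Quotient r → Y}
    (hf : DSmooth fun x => f (Quotient.mk r x)) : DSmooth f := by
  intro n p hp
  -- A plot of the quotient lifts only near each point, so smoothness is checked locally.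
  refine DiffeologicalSpace.locality fun x => ?_
  obtain ⟨q, hq, h⟩ := isPlot_quotient_iff.1 hp x
  obtain ⟨u, hu, hu', hx⟩ := eventually_nhds_iff.1 h
  refine ⟨u, hu', hx, fun {m g} hg hg' => ?_⟩
  have : (f ∘ p) ∘ g = (fun x => f (Quotient.mk r x)) ∘ (q ∘ g) := by
    ext y
    simp [hu _ (hg y)]
  exact this ▸ hf _ _ (isPlot_reparam hq hg')

end SmoothStructure

/-! ### Smooth dependence of momentum, locked inertia and lifts on parameters -/

namespace Chaplygin

variable {d : ℕ} {E : Type*} [NormedAddCommGroup E] [NormedSpace ℝ E] {x : E}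

theorem matrixSmoothAt_inertia (I : InertiaTensor d) {u : E → so d}
    (hu : MatrixSmoothAt (fun y => (u y).1) x) :
    MatrixSmoothAt (fun y => (I.map (u y)).1) x := by
  intro i j
  let ι : so d →ₗ[ℝ] Matrix (Fin (d + 1)) (Fin (d + 1)) ℝ :=
    { toFun := fun u => u.1, map_add' := fun _ _ => rfl, map_smul' := fun _ _ => rfl }
  -- A linear retraction onto `so(n)` extends `𝕀` to all matrices, so that its entries become linear
  -- functionals of a matrix.
  obtain ⟨g, hg⟩ := ι.exists_leftInverse_of_injective
    (LinearMap.ker_eq_bot.2 Subtype.val_injective)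
  have h : ∀ y, (I.map (u y)).1 i j =
      (Matrix.entryLinearMap ℝ ℝ i j ∘ₗ ι ∘ₗ I.map ∘ₗ g) (u y).1 := fun y =>
    congrArg (fun v => (I.map v).1 i j) (LinearMap.congr_fun hg (u y)).symm
  simp_rw [h]
  exact hu.linearMap _

theorem contDiffAt_matrixMomentum (I : InertiaTensor d)
    {A : E → Matrix (Fin (d + 1)) (Fin (d + 1)) ℝ} {u : E → so d} {Y : E → LieH d}
    (hA : MatrixSmoothAt A x) (hu : MatrixSmoothAt (fun y => (u y).1) x)
    (hY : MatrixSmoothAt (fun y => (Y y).1.1) x) :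
    ContDiffAt ℝ ∞ (fun y => matrixMomentum I (A y) (u y) (Y y)) x :=
  contDiffAt_const.mul
    ((matrixSmoothAt_inertia I hu).mul ((hA.transpose.mul hY).mul hA)).trace

theorem matrixSmoothAt_generator {s : E → SO d} {Y : E → LieH d}
    (hs : MatrixSmoothAt (fun y => (s y).1) x) (hY : MatrixSmoothAt (fun y => (Y y).1.1) x) :
    MatrixSmoothAt (fun y => (generator (s y) (Y y)).1) x := by
  have h : ∀ y, (generator (s y) (Y y)).1 = (s y).1ᵀ * (Y y).1.1 * (s y).1 :=
    fun y => coe_Ad_inv _ _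
  simp_rw [h]
  exact (hs.transpose.mul hY).mul hs

theorem matrixSmoothAt_lockedInertia_symm (I : InertiaTensor d) {s : E → SO d} {ν : E → DualH d}
    (hs : MatrixSmoothAt (fun y => (s y).1) x) (hν : ∀ Y, ContDiffAt ℝ ∞ (fun y => ν y Y) x) :
    MatrixSmoothAt (fun y => ((lockedInertia I (s y)).symm (ν y)).1.1) x := by
  let b := Module.finBasis ℝ (LieH d)
  -- In a fixed basis of `𝔥` and its dual basis, the `(i, j)` entry is `𝕃(s)(b_j)(b_i)`, a smooth
  -- function; inverting this matrix inverts `𝕃(s)`.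
  let M : E → Matrix _ _ ℝ := fun y =>
    LinearMap.toMatrix b b.dualBasis (lockedInertia I (s y)).toLinearMap
  have hdet : ∀ y, IsUnit (M y).det := fun y => LinearEquiv.isUnit_det _ _ _
  have hM : MatrixSmoothAt M x := by
    intro i j
    have h : ∀ y, M y i j = matrixMomentum I (s y).1 (generator (s y) (b j)) (b i) := by
      intro y
      refine (LinearMap.toMatrix_apply _ _ _ _ _).trans ?_
      rw [Module.Basis.dualBasis_repr, LinearEquiv.coe_coe,
        ← momentum_generator, momentum_eq_matrixMomentum]
    simp_rw [h]
    exact contDiffAt_matrixMomentum I hs (matrixSmoothAt_generator hs (.const _)) (.const _)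
  have hc : ∀ y, (lockedInertia I (s y)).symm (ν y) =
      ∑ i, ((M y)⁻¹ *ᵥ fun j => ν y (b j)) i • b i := by
    intro y
    have h : (M y) *ᵥ b.repr ((lockedInertia I (s y)).symm (ν y)) = fun j => ν y (b j) := by
      ext j
      rw [LinearMap.toMatrix_mulVec_repr, Module.Basis.dualBasis_repr, LinearEquiv.coe_coe,
        LinearEquiv.apply_symm_apply]
    rw [← h, Matrix.mulVec_mulVec, Matrix.nonsing_inv_mul _ (hdet y), Matrix.one_mulVec,
      b.sum_repr]
  have hc' : ∀ y, ((lockedInertia I (s y)).symm (ν y)).1.1 =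
      ∑ i, ((M y)⁻¹ *ᵥ fun j => ν y (b j)) i • (b i).1.1 := by
    intro y
    rw [hc]
    push_cast
    rfl
  intro i j
  simp_rw [hc', Matrix.sum_apply]
  exact ContDiffAt.sum fun a _ =>
    ((hM.inv (hdet x).ne_zero).mulVec (fun j => hν (b j)) a).mul contDiffAt_const

theorem matrixSmoothAt_withMomentum (I : InertiaTensor d) {s : E → SO d} {w : E → so d}
    {ν : E → DualH d} (hs : MatrixSmoothAt (fun y => (s y).1) x)
    (hw : MatrixSmoothAt (fun y => (w y).1) x) (hν : ∀ Y, ContDiffAt ℝ ∞ (fun y => ν y Y) x) :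
    MatrixSmoothAt (fun y => (withMomentum I (s y) (w y) (ν y)).1) x := by
  refine hw.add (matrixSmoothAt_generator hs (matrixSmoothAt_lockedInertia_symm I hs fun Y => ?_))
  refine (hν Y).sub ?_
  simp_rw [momentum_eq_matrixMomentum]
  exact contDiffAt_matrixMomentum I hs hw (.const _)

theorem matrixSmoothAt_wedge {a v : E → EuclideanSpace ℝ (Fin (d + 1))}
    (ha : ∀ i, ContDiffAt ℝ ∞ (fun y => a y i) x) (hv : ∀ i, ContDiffAt ℝ ∞ (fun y => v y i) x) :
    MatrixSmoothAt (fun y => (wedge (a y) (v y)).1) x :=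
  (MatrixSmoothAt.vecMulVec ha hv).sub (.vecMulVec hv ha)

theorem contDiffAt_proj {s : E → SO d} (hs : MatrixSmoothAt (fun y => (s y).1) x)
    (i : Fin (d + 1)) : ContDiffAt ℝ ∞ (fun y => proj (s y) i) x :=
  hs.transpose.mulVec (b := fun _ => eLast d) (fun _ => contDiffAt_const) i

/-! ### Smoothness of the reduced map and of its inverse -/

open SmoothStructure

variable {k : ℕ} {O : Set (DualH d)}

theorem isPlot_SO_iff {s : EuclideanSpace ℝ (Fin k) → SO d} :
    IsPlot s ↔ ∀ x, MatrixSmoothAt (fun y => (s y).1) x :=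
  isPlot_matrix_iff

theorem isPlot_so_iff {u : EuclideanSpace ℝ (Fin k) → so d} :
    IsPlot u ↔ ∀ x, MatrixSmoothAt (fun y => (u y).1) x :=
  isPlot_matrix_iff

theorem isPlot_TS_iff {p : EuclideanSpace ℝ (Fin k) → TS d} :
    IsPlot p ↔ (∀ x, MatrixSmoothAt (fun y => (p y).base.1) x) ∧
      ∀ x, MatrixSmoothAt (fun y => (p y).vel.1) x :=
  (isPlot_prod_iff (p := fun y => ((p y).base, (p y).vel))).trans
    (and_congr isPlot_SO_iff isPlot_so_iff)

theorem isPlot_TSphere_iff {z : EuclideanSpace ℝ (Fin k) → TSphere d} :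
    IsPlot z ↔ (∀ x i, ContDiffAt ℝ ∞ (fun y => (z y).1.1 i) x) ∧
      ∀ x i, ContDiffAt ℝ ∞ (fun y => (z y).1.2 i) x :=
  isPlot_prod_iff.trans (and_congr isPlot_euclideanSpace_iff isPlot_euclideanSpace_iff)

theorem dSmooth_tangentProj : DSmooth (tangentProj : TS d → TSphere d) := by
  intro k p hp
  obtain ⟨hs, hu⟩ := isPlot_TS_iff.1 hp
  exact isPlot_TSphere_iff.2 ⟨fun x i => contDiffAt_proj (hs x) i,
    fun x i => ((hu x).mulVec (fun j => contDiffAt_proj (hs x) j) i).neg⟩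

theorem dSmooth_momentum (I : InertiaTensor d) : DSmooth (momentum I) := by
  intro k p hp
  obtain ⟨hs, hu⟩ := isPlot_TS_iff.1 hp
  refine isPlot_dual_iff.2 fun x Y => ?_
  simp_rw [Function.comp_apply, momentum_eq_matrixMomentum]
  exact contDiffAt_matrixMomentum I (hs x) (hu x) (.const _)

theorem dSmooth_reducedMap (I : InertiaTensor d) (O : Set (DualH d)) :
    DSmooth (reducedMap I O) := by
  refine dSmooth_of_comp_mk fun k p hp => ?_
  refine isPlot_subtype_iff.2 (isPlot_prod_iff.2 ⟨dSmooth_tangentProj k _ hp, ?_⟩)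
  let q : EuclideanSpace ℝ (Fin k) → SO d × {ν : DualH d // ν ∈ O} :=
    fun y => ((p y).1.base, ⟨momentum I (p y).1, (p y).2⟩)
  exact isPlot_mk (p := q) ⟨isPlot_SO_iff.2 (isPlot_TS_iff.1 hp).1, dSmooth_momentum I k _ hp⟩

/-- The tangent vector at `s` over `z` of momentum `ν`, as a point of the level set. -/
noncomputable def levelPoint (I : InertiaTensor d) (z : TSphere d) (s : SO d)
    (ν : {ν : DualH d // ν ∈ O}) : MomentumLevel I O :=
  ⟨⟨s, withMomentum I s (wedge z.1.1 z.1.2) ν.1⟩, withMomentum_mem I s _ ν⟩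

theorem isPlot_levelPoint (I : InertiaTensor d) {z : EuclideanSpace ℝ (Fin k) → TSphere d}
    {s : EuclideanSpace ℝ (Fin k) → SO d}
    {ν : EuclideanSpace ℝ (Fin k) → {ν : DualH d // ν ∈ O}} (hz : IsPlot z) (hs : IsPlot s)
    (hν : IsPlot ν) : IsPlot fun y => levelPoint I (z y) (s y) (ν y) := by
  obtain ⟨ha, hv⟩ := isPlot_TSphere_iff.1 hz
  have hs := isPlot_SO_iff.1 hs
  exact isPlot_TS_iff.2 ⟨hs, fun x => matrixSmoothAt_withMomentum I (hs x)
    (matrixSmoothAt_wedge (ha x) (hv x)) (isPlot_dual_iff.1 hν x)⟩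

/-- Only the component in `S ×_H 𝒪` has to be lifted locally, to some `(s, ν)`; the level point is
then an explicit smooth function of `(x, v)`, `s` and `ν`. -/
theorem dSmooth_reducedEquiv_symm (I : InertiaTensor d) (O : Set (DualH d)) :
    DSmooth (reducedEquiv I O).symm := by
  intro k p hp
  refine isPlot_quotient_iff.2 fun x => ?_
  obtain ⟨q, hq, h⟩ := isPlot_quotient_iff.1 (isPlot_prod_iff.1 (isPlot_subtype_iff.1 hp)).2 x
  refine ⟨fun y => levelPoint I (p y).1.1 (q y).1 (q y).2,
    isPlot_levelPoint I (isPlot_prod_iff.1 (isPlot_subtype_iff.1 hp)).1 hq.1 hq.2, ?_⟩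
  filter_upwards [h] with y hy
  exact reducedEquiv_symm_eq I hy

theorem isDiffeo_reducedEquiv (I : InertiaTensor d) (O : Set (DualH d)) :
    IsDiffeo (reducedEquiv I O) :=
  ⟨dSmooth_reducedMap I O, dSmooth_reducedEquiv_symm I O⟩

end Chaplygin

/-! ### Householder reflections -/

section Householder

variable {n : Type*} [Fintype n] [DecidableEq n]

/-- The reflection `1 - 2 w wᵀ / |w|²`. -/
noncomputable def householder (w : n → ℝ) : Matrix n n ℝ :=
  1 - (2 / (w ⬝ᵥ w)) • Matrix.vecMulVec w w

theorem householder_transpose (w : n → ℝ) : (householder w)ᵀ = householder w := by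
  simp [householder, Matrix.transpose_vecMulVec]

theorem householder_mulVec (w v : n → ℝ) :
    householder w *ᵥ v = v - (2 * (w ⬝ᵥ v) / (w ⬝ᵥ w)) • w := by
  rw [householder, Matrix.sub_mulVec, Matrix.one_mulVec, Matrix.smul_mulVec,
    Matrix.vecMulVec_mulVec]
  ext i
  simp
  ring

theorem householder_mul_self {w : n → ℝ} (hw : w ≠ 0) : householder w * householder w = 1 := by
  have hw' : w ⬝ᵥ w ≠ 0 := fun h => hw (dotProduct_self_eq_zero.1 h)
  refine Matrix.ext_of_mulVec_single fun i => ?_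
  rw [← Matrix.mulVec_mulVec, Matrix.one_mulVec, householder_mulVec _ (householder w *ᵥ _),
    householder_mulVec]
  ext j
  simp only [dotProduct_sub, dotProduct_smul, Pi.sub_apply, Pi.smul_apply, smul_eq_mul]
  field_simp
  ring

theorem det_householder {w : n → ℝ} (hw : w ≠ 0) : (householder w).det = -1 := by
  have hw' : w ⬝ᵥ w ≠ 0 := fun h => hw (dotProduct_self_eq_zero.1 h)
  -- A rank-one perturbation of the identity: `det (1 + a bᵀ) = 1 + b ⬝ᵥ a`.
  have h : householder w = 1 + Matrix.replicateCol Unit (-(2 / (w ⬝ᵥ w)) • w) *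
      Matrix.replicateRow Unit w := by
    ext i j
    simp [householder, Matrix.mul_apply, Matrix.vecMulVec_apply]
    ring
  rw [h, Matrix.det_one_add_replicateCol_mul_replicateRow, dotProduct_smul, smul_eq_mul]
  field_simp
  norm_num

/-- Vectors of equal length are mirror images in the hyperplane orthogonal to their difference. -/
theorem householder_sub_mulVec {a x : n → ℝ} (h : a ⬝ᵥ a = x ⬝ᵥ x) (hne : x ≠ a) :
    householder (x - a) *ᵥ a = x := by
  have hw : (x - a) ⬝ᵥ (x - a) ≠ 0 := fun h => hne (sub_eq_zero.1 (dotProduct_self_eq_zero.1 h))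
  have h1 : 2 * ((x - a) ⬝ᵥ a) = -((x - a) ⬝ᵥ (x - a)) := by
    simp only [sub_dotProduct, dotProduct_sub, dotProduct_comm a x]
    linarith
  rw [householder_mulVec, h1, neg_div, div_self hw]
  simp

end Householder

namespace Chaplygin

variable {d : ℕ}

/-! ### Local sections of `κ` and local triviality -/

open SmoothStructure

theorem dotProduct_self_of_norm_eq_one {x : EuclideanSpace ℝ (Fin (d + 1))} (h : ‖x‖ = 1) :
    x.ofLp ⬝ᵥ x.ofLp = 1 := by
  have := EuclideanSpace.norm_sq_eq x
  rw [h] at this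
  simpa [dotProduct, sq] using this.symm

theorem eLast_dotProduct_self : eLast d ⬝ᵥ eLast d = 1 := by simp [eLast]

/-- A local section of `κ`, through the auxiliary unit vector `a`. -/
noncomputable def sectionMatrix (a x : Fin (d + 1) → ℝ) : Matrix (Fin (d + 1)) (Fin (d + 1)) ℝ :=
  householder (a - eLast d) * householder (x - a)

/-- Two reflections are needed because one has determinant `-1`; the inequalities keep both mirrors
nondegenerate. -/
theorem sectionMatrix_mem {a x : Fin (d + 1) → ℝ} (ha : a ≠ eLast d) (hx : x ≠ a) :
    sectionMatrix a x ∈ Matrix.specialOrthogonalGroup (Fin (d + 1)) ℝ := by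
  have ha := sub_ne_zero.2 ha
  have hx := sub_ne_zero.2 hx
  rw [Matrix.mem_specialOrthogonalGroup_iff, Matrix.mem_orthogonalGroup_iff]
  constructor
  · change sectionMatrix a x * (sectionMatrix a x)ᵀ = 1
    rw [sectionMatrix, Matrix.transpose_mul, householder_transpose, householder_transpose,
      Matrix.mul_assoc, ← Matrix.mul_assoc (householder (x - a)), householder_mul_self hx,
      Matrix.one_mul, householder_mul_self ha]
  · rw [sectionMatrix, Matrix.det_mul, det_householder ha, det_householder hx]
    norm_num

/-- The rotation given by `sectionMatrix`. -/
noncomputable def sectionSO {a x : Fin (d + 1) → ℝ} (ha : a ≠ eLast d) (hx : x ≠ a) : SO d :=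
  ⟨sectionMatrix a x, sectionMatrix_mem ha hx⟩

theorem proj_sectionSO {a : Fin (d + 1) → ℝ} {x : EuclideanSpace ℝ (Fin (d + 1))}
    (ha : a ≠ eLast d) (ha' : a ⬝ᵥ a = 1) (hx : x.ofLp ≠ a) (hx' : ‖x‖ = 1) :
    proj (sectionSO ha hx) = x := by
  have h : (sectionMatrix a x.ofLp)ᵀ *ᵥ eLast d = x.ofLp := by
    -- Transposing reverses the factors, so `e_n` is reflected first to `a` and then to `x`.
    rw [sectionMatrix, Matrix.transpose_mul, householder_transpose, householder_transpose,
      ← Matrix.mulVec_mulVec, householder_sub_mulVec (eLast_dotProduct_self.trans ha'.symm) ha,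
      householder_sub_mulVec (ha'.trans (dotProduct_self_of_norm_eq_one hx').symm) hx]
  exact congrArg (WithLp.toLp 2) h

theorem exists_smul_eq_of_proj_eq {s t : SO d} (h : proj s = proj t) : ∃ g : H d, g • t = s := by
  refine ⟨⟨s * t⁻¹, ?_⟩, ?_⟩
  · have h1 : s.1ᵀ *ᵥ eLast d = t.1ᵀ *ᵥ eLast d := congrArg WithLp.ofLp h
    change (s.1 * t.1ᵀ) *ᵥ eLast d = eLast d
    rw [← Matrix.mulVec_mulVec, ← h1, Matrix.mulVec_mulVec, coe_mul_transpose, Matrix.one_mulVec]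
  · exact inv_mul_cancel_right s t

theorem smul_mk (g : H d) (s : SO d) (u : so d) : g • (⟨s, u⟩ : TS d) = ⟨g • s, u⟩ := rfl

section MatrixSmooth

variable {E : Type*} [NormedAddCommGroup E] [NormedSpace ℝ E] {y₀ : E}

theorem matrixSmoothAt_sectionMatrix {a : Fin (d + 1) → ℝ} {x : E → Fin (d + 1) → ℝ}
    (hx : ∀ i, ContDiffAt ℝ ∞ (fun y => x y i) y₀) (hne : x y₀ ≠ a) :
    MatrixSmoothAt (fun y => sectionMatrix a (x y)) y₀ := by
  have hw : ∀ i, ContDiffAt ℝ ∞ (fun y => (x y - a) i) y₀ := fun i => (hx i).sub contDiffAt_const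
  refine (MatrixSmoothAt.const _).mul ((MatrixSmoothAt.const 1).sub (.smul ?_ (.vecMulVec hw hw)))
  refine contDiffAt_const.div (ContDiffAt.sum fun i _ => (hw i).mul (hw i)) ?_
  exact fun h => hne (sub_eq_zero.1 (dotProduct_self_eq_zero.1 h))

end MatrixSmooth

variable {O : Set (DualH d)}

/-- The momentum at the point of the local section over `κ(s)`. -/
noncomputable def sectionMomentum (I : InertiaTensor d) (O : Set (DualH d)) (a : Fin (d + 1) → ℝ) :
    ReducedSpace I O → DualH d :=
  Quotient.lift (fun p : MomentumLevel I O =>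
    matrixMomentum I (sectionMatrix a (proj p.1.base).ofLp) p.1.vel) (by
      rintro ⟨p, hp⟩ ⟨q, hq⟩ ⟨h, hh⟩
      have hh : h • q = p := hh
      subst hh
      -- The formula sees the base point only through `κ`, and the action fixes the body velocity.
      have h1 : proj (h • q).base = proj q.base := proj_smul h q.base
      change matrixMomentum I (sectionMatrix a (proj (h • q).base).ofLp) q.vel = _
      rw [h1])

/-- The projection `J_H⁻¹(𝒪)/H → TSⁿ⁻¹`. -/
noncomputable def reducedProj (I : InertiaTensor d) (O : Set (DualH d)) (x : ReducedSpace I O) :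
    TSphere d :=
  (reducedEquiv I O x).1.1

theorem dSmooth_reducedProj (I : InertiaTensor d) (O : Set (DualH d)) :
    DSmooth (reducedProj I O) :=
  fun k p hp => (isPlot_prod_iff.1 (isPlot_subtype_iff.1 (dSmooth_reducedMap I O k p hp))).1

/-- Some `g ∈ H` carries `s` to the section without changing `u`; the momentum moves by `g` and
stays in the orbit. -/
theorem sectionMomentum_mem {l : DualH d} (hO : O = MulAction.orbit (H d) l) (I : InertiaTensor d)
    {a : Fin (d + 1) → ℝ} (ha : a ≠ eLast d) (ha' : a ⬝ᵥ a = 1) (x : ReducedSpace I O)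
    (hx : (reducedProj I O x).1.1.ofLp ≠ a) : sectionMomentum I O a x ∈ O := by
  obtain ⟨⟨⟨s, u⟩, hp⟩, rfl⟩ := Quotient.exists_rep x
  have hx : (proj s).ofLp ≠ a := hx
  obtain ⟨g, hg⟩ := exists_smul_eq_of_proj_eq
    (proj_sectionSO ha ha' hx (norm_proj s))
  change matrixMomentum I (sectionMatrix a (proj s).ofLp) u ∈ O
  have h : momentum I (g • ⟨s, u⟩) = matrixMomentum I (sectionMatrix a (proj s).ofLp) u := by
    rw [smul_mk, hg, momentum_eq_matrixMomentum]
    rfl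
  rw [← h, momentum_smul]
  subst hO
  exact MulAction.mem_orbit_of_mem_orbit g hp

/-- The local trivialization of `J_H⁻¹(𝒪)/H → TSⁿ⁻¹` away from the fibres over `a`. -/
noncomputable def localTrivialization {l : DualH d} (hO : O = MulAction.orbit (H d) l)
    (I : InertiaTensor d) {a : Fin (d + 1) → ℝ} (ha : a ≠ eLast d) (ha' : a ⬝ᵥ a = 1) :
    {x : ReducedSpace I O // reducedProj I O x ∈ {z : TSphere d | z.1.1.ofLp ≠ a}} ≃
      {z : TSphere d // z ∈ {z : TSphere d | z.1.1.ofLp ≠ a}} × {ν : DualH d // ν ∈ O} where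
  toFun x := (⟨reducedProj I O x.1, x.2⟩,
    ⟨sectionMomentum I O a x.1, sectionMomentum_mem hO I ha ha' x.1 x.2⟩)
  invFun y := ⟨Quotient.mk _ (levelPoint I y.1.1 (sectionSO ha y.1.2) y.2), by
    have h : reducedProj I O (Quotient.mk _ (levelPoint I y.1.1 (sectionSO ha y.1.2) y.2)) = y.1.1 :=
      tangentProj_withMomentum I y.1.1 (proj_sectionSO ha ha' y.1.2 y.1.1.2.1) y.2.1
    rw [h]
    exact y.1.2⟩
  left_inv := by
    rintro ⟨⟨⟨⟨s, u⟩, hp⟩⟩, hx⟩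
    have hx : (proj s).ofLp ≠ a := hx
    have hs := proj_sectionSO ha ha' hx (norm_proj s)
    obtain ⟨g, hg⟩ := exists_smul_eq_of_proj_eq hs
    apply Subtype.ext
    refine ReducedSpace.mk_eq_iff.2 ⟨g, TS.ext hg ?_⟩
    -- Once the base points agree on the section, both velocities have the same tangent projection
    -- and momentum.
    apply eq_of_tangentProj_eq_of_momentum_eq (I := I) (s := sectionSO ha hx)
    · have h : tangentProj ⟨sectionSO ha hx, u⟩ = tangentProj ⟨s, u⟩ := by
        rw [← hg, ← smul_mk, tangentProj_smul]
      exact h.trans (tangentProj_withMomentum I (tangentProj ⟨s, u⟩) hs _).symm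
    · refine Eq.trans ?_ (momentum_withMomentum I _ _ _).symm
      exact momentum_eq_matrixMomentum I _
  right_inv := by
    rintro ⟨⟨z, hz⟩, ν⟩
    have hs := proj_sectionSO ha ha' hz z.2.1
    refine Prod.ext (Subtype.ext (tangentProj_withMomentum I z hs ν.1)) (Subtype.ext ?_)
    refine Eq.trans ?_ (momentum_withMomentum I (sectionSO ha hz) (wedge z.1.1 z.1.2) ν.1)
    rw [momentum_eq_matrixMomentum]
    exact congrArg (fun x => matrixMomentum I (sectionMatrix a x)
      (withMomentum I (sectionSO ha hz) (wedge z.1.1 z.1.2) ν.1)) (congrArg WithLp.ofLp hs)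

theorem isDiffeo_localTrivialization {l : DualH d} (hO : O = MulAction.orbit (H d) l)
    (I : InertiaTensor d) {a : Fin (d + 1) → ℝ} (ha : a ≠ eLast d) (ha' : a ⬝ᵥ a = 1) :
    IsDiffeo (localTrivialization hO I ha ha') := by
  constructor
  · intro k p hp
    have hp := isPlot_subtype_iff.1 hp
    refine isPlot_prod_iff.2 ⟨dSmooth_reducedProj I O k _ hp, isPlot_dual_iff.2 fun x Y => ?_⟩
    obtain ⟨q, hq, h⟩ := isPlot_quotient_iff.1 hp x
    obtain ⟨hs, hu⟩ := isPlot_TS_iff.1 hq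
    -- The lift `q` may cross the fibre over `a` away from `x`, where `sectionMatrix` is no
    -- rotation. `matrixMomentum` accepts any matrix, so the condition at `x` suffices.
    have hx : (proj (q x).1.base).ofLp ≠ a := by
      have := (p x).2
      rw [h.self_of_nhds] at this
      exact this
    refine (contDiffAt_matrixMomentum I (matrixSmoothAt_sectionMatrix
      (fun i => contDiffAt_proj (hs x) i) hx) (hu x) (.const Y.1.1)).congr_of_eventuallyEq ?_
    filter_upwards [h] with y hy
    exact congrArg (fun z => sectionMomentum I O a z Y) hy
  · intro k p hp
    obtain ⟨hz, hν⟩ := isPlot_prod_iff.1 hp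
    refine isPlot_subtype_iff.2 (isPlot_mk (isPlot_levelPoint I hz (isPlot_SO_iff.2 fun x => ?_) hν))
    exact matrixSmoothAt_sectionMatrix ((isPlot_TSphere_iff.1 hz).1 x) (p x).1.2

/-- The vector `-e_n` works unless `x = -e_n`; then the first basis vector does, which differs from
`±e_n` since `1 ≤ d`. Hence the complements of such `a` cover the sphere. -/
theorem exists_unit_vector_ne (hd : 1 ≤ d) (x : Fin (d + 1) → ℝ) :
    ∃ a : Fin (d + 1) → ℝ, a ⬝ᵥ a = 1 ∧ a ≠ eLast d ∧ x ≠ a := by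
  have h0 : (0 : Fin (d + 1)) ≠ Fin.last d := by
    rw [Ne, Fin.ext_iff, Fin.val_zero, Fin.val_last]; omega
  by_cases hx : x = -eLast d
  · refine ⟨Pi.single 0 1, by simp, fun h => ?_, fun h => ?_⟩
    · simpa [eLast, h0] using congrFun h 0
    · simpa [hx, eLast, h0] using congrFun h 0
  · refine ⟨-eLast d, by simp [eLast_dotProduct_self], fun h => ?_, hx⟩
    have := congrFun h (Fin.last d)
    simp [eLast] at this
    linarith

theorem isFiberBundle_reducedProj (hd : 1 ≤ d) {l : DualH d} (hO : O = MulAction.orbit (H d) l)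
    (I : InertiaTensor d) : IsFiberBundle {ν : DualH d // ν ∈ O} (reducedProj I O) := by
  refine ⟨dSmooth_reducedProj I O, fun b => ?_⟩
  obtain ⟨a, ha', ha, hb⟩ := exists_unit_vector_ne hd b.1.1.ofLp
  refine ⟨{z | z.1.1.ofLp ≠ a}, ?_, hb, localTrivialization hO I ha ha',
    isDiffeo_localTrivialization hO I ha ha', fun _ => rfl⟩
  exact isOpen_ne_fun (by fun_prop) continuous_const

end Chaplygin

theorem corollary4p2 (d : ℕ) (hd : 2 ≤ d) (I : Chaplygin.InertiaTensor d)
    (O : Set (Chaplygin.DualH d))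
    (hO : ∃ l : Chaplygin.DualH d, O = MulAction.orbit (Chaplygin.H d) l) :
    ∃ Φ : Chaplygin.ReducedSpace I O ≃ Chaplygin.FiberProduct O,
      SmoothStructure.IsDiffeo Φ ∧
      -- `Φ [s, u] = (Tκ(s, u), [s, J_H(s, u)])`
      (∀ (p : Chaplygin.TS d) (hp : Chaplygin.momentum I p ∈ O),
        (Φ (Chaplygin.ReducedSpace.mk p hp)).1 =
          (Chaplygin.tangentProj p,
            Chaplygin.AssociatedBundle.mk p.base ⟨Chaplygin.momentum I p, hp⟩)) ∧
      -- `Φ⁻¹ ((x, v), [s, ν]) = [s, u + ζ_{𝕃(s)⁻¹ν}(s)]`, where `u` is the horizontal lift of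
      -- `(x, v)` to `s` for the mechanical connection
      (∀ (z : Chaplygin.FiberProduct O) (s : Chaplygin.SO d)
        (ν : {ν : Chaplygin.DualH d // ν ∈ O}),
        z.1.2 = Chaplygin.AssociatedBundle.mk s ν →
        ∃ u : Chaplygin.so d,
          (∀ w : Chaplygin.so d, (Chaplygin.mechanicalConnection I ⟨s, w⟩ = 0 ∧
            Chaplygin.tangentProj ⟨s, w⟩ = z.1.1) ↔ w = u) ∧
          ∃ hJ : Chaplygin.momentum I
              ⟨s, u + Chaplygin.generator s ((Chaplygin.lockedInertia I s).symm ν.1)⟩ ∈ O,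
            Φ.symm z = Chaplygin.ReducedSpace.mk _ hJ) ∧
      -- the reduced space is a bundle over `TSⁿ⁻¹` with fibre `𝒪`
      SmoothStructure.IsFiberBundle {ν : Chaplygin.DualH d // ν ∈ O}
        (fun x : Chaplygin.ReducedSpace I O => (Φ x).1.1) := by
  obtain ⟨l, hO⟩ := hO
  exact ⟨Chaplygin.reducedEquiv I O, Chaplygin.isDiffeo_reducedEquiv I O,
    fun p hp => Chaplygin.reducedMap_mk I p hp, Chaplygin.exists_horizontal_lift I,
    Chaplygin.isFiberBundle_reducedProj (by omega) hO I⟩
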